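/- Let $H_1,H_2$ be finitely generated groups, let $A$ be an infinite cyclic group with injective, non-surjective homomorphisms $\phi\colon A\to H_1$ and $\psi\colon A\to H_2$, and let $G=H_1\ast_A H_2$ be the corresponding amalgamated free product. Assume that the image of $A$ in $G$ is malnormal, i.e. $gAg^{-1}\cap A=\{1\}$ for all $g\in G\setminus A$. For $n\ge 1$, a non-trivial group is called an $n$-free product of cyclics if each of its subgroups that can be generated by $n$ elements is a free product of at most $n$ cyclic groups (finite cyclic factors are allowed). The rank $\mathrm{rk}(H)$ of a finitely generated group $H$ is the least number of elements generating $H$. If $\mathrm{rk}(H_1)\ge 2$ and $\mathrm{rk}(H_2)\ge 2$, and $H_1$ and $H_2$ are 2-free products of cyclics, then $G$ is a 2-free product of cyclics. In particular, every 2-generated subgroup of $G$ is a free product of at most 2 cyclic groups. -/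

import Mathlib

/-- A group is a free product of at most `n` cyclic groups. The cyclic factors may be finite, infinite
or trivial. (Cyclic groups are countable, so restricting the factors to `Type` loses nothing.) -/
def IsFreeProductOfCyclics (n : ℕ) (K : Type*) [Group K] : Prop :=
  ∃ m : ℕ, m ≤ n ∧ ∃ (C : Fin m → Type) (_ : ∀ i, Group (C i)),
    (∀ i, IsCyclic (C i)) ∧ Nonempty (K ≃* Monoid.CoprodI C)

/-- A subgroup is `n`-generated if it is generated by `n` (not necessarily distinct) elements. -/
def Subgroup.IsNGenerated {G : Type*} [Group G] (n : ℕ) (K : Subgroup G) : Prop :=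
  ∃ g : Fin n → G, Subgroup.closure (Set.range g) = K

/-- A non-trivial group is an `n`-free product of cyclics if each of its `n`-generated subgroups
is a free product of at most `n` cyclic groups. -/
structure IsNFreeProductOfCyclics (n : ℕ) (G : Type*) [Group G] : Prop where
  nontrivial : Nontrivial G
  of_isNGenerated : ∀ K : Subgroup G, K.IsNGenerated n → IsFreeProductOfCyclics n K

/-- A subgroup `A` of `G` is malnormal if `g A g⁻¹ ∩ A = 1` for all `g ∈ G` outside `A`. -/
def Subgroup.IsMalnormal {G : Type*} [Group G] (A : Subgroup G) : Prop :=
  ∀ g : G, g ∉ A → ∀ a ∈ A, g * a * g⁻¹ ∈ A → a = 1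

/-!
The amalgamated product `G` acts on its Bass–Serre tree, whose vertices are the cosets of the two
factors. Malnormality of the amalgamated subgroup says that a nontrivial element of `G` never fixes
two edges with a common endpoint (`isEdgeRigidTreeAction_tree`). For any such action on a tree, a
subgroup generated by two elements either is a free product of at most two cyclic groups or fixes a
vertex (`isFreeProductOfCyclics_or_le_stabilizer`). A subgroup fixing a vertex embeds in one of the
factors, where the hypothesis on the factors applies.

To analyse a two-generated subgroup, choose generators `x`, `y` for which the sum of the translation
lengths is least. Each of the remaining configurations is settled by Klein's combination theorem
(`isFreeProductOfCyclics_closure_pair`): it suffices to find sets `D` and `E` of vertices, covering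
the tree, that are moved off themselves by the nontrivial powers of `x` and of `y` respectively. They
are built from half-trees, the components left after removing an edge.

* If no vertex is moved least by both `x` and `y`, the half-trees at the two ends of a shortest path
  between the two sets of least moved vertices serve as `D` and `E`.
* If `x` is elliptic with a fixed point on the axis of `y`, the set `E` is the part of the tree over a
  fundamental segment of the axis, and `D` consists of the two half-trees in the directions of the
  axis, at the fixed point or at the fixed edge of `x`. A power of `x` exchanging these two directions
  would allow `y` to be shortened.
* If both are hyperbolic and their axes meet, minimality makes the common segment shorter than both
  translation lengths, and fundamental domains of the two translations starting at one end of this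
  segment serve as `D` and `E`.
* If both fix a common vertex, so does the subgroup.

That the Bass–Serre graph is a tree follows from the normal form theorem: the length of normal forms
gives a level function for which each vertex has at most one neighbour that is not higher.
-/

/-! ### Ping-pong for two factors -/

namespace Monoid.CoprodI

open scoped Pointwise

variable {G α : Type*} [Group G] [MulAction G α]

theorem NeWord.head_ne_one {ι : Type*} {M : ι → Type*} [∀ i, Monoid (M i)] {i j : ι}
    (w : NeWord M i j) : w.head ≠ 1 := by
  induction w with
  | singleton x hx => simpa using hx
  | append w₁ _ w₂ ih₁ _ => simpa using ih₁

/-- A reduced word moves every ping-pong set not matching its last letter into the translate, under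
its first letter, of another ping-pong set. -/
theorem lift_neWord_smul_subset {ι : Type*} {H : ι → Type*} [∀ i, Group (H i)]
    (f : ∀ i, H i →* G) (X : ι → Set α)
    (hpp : Pairwise fun i j => ∀ h : H i, h ≠ 1 → f i h • X j ⊆ X i) {i j k : ι}
    (w : NeWord H i j) (hk : j ≠ k) :
    ∃ l, l ≠ i ∧ lift f w.prod • X k ⊆ f i w.head • X l := by
  induction w generalizing k with
  | singleton x hx => exact ⟨k, hk.symm, by simp⟩
  | @append i j l m w₁ hne w₂ ih₁ _ =>
    obtain ⟨n, hn, hsub⟩ := ih₁ hne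
    refine ⟨n, hn, ?_⟩
    have h₂ : lift f w₂.prod • X k ⊆ X l := lift_word_ping_pong f X hpp w₂ hk
    calc lift f (NeWord.append w₁ hne w₂).prod • X k
        = lift f w₁.prod • lift f w₂.prod • X k := by simp [mul_smul]
      _ ⊆ lift f w₁.prod • X l := Set.smul_set_subset_smul_set_iff.mpr h₂
      _ ⊆ _ := by simpa using hsub

/-- A ping-pong lemma for two groups that also covers two groups of order two: in place of a
cardinality condition, some point of `X 0` is missed by all translates of `X 1` under nontrivial
elements of the first group. -/
theorem lift_injective_of_ping_pong_of_point {H : Fin 2 → Type*} [∀ i, Group (H i)]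
    (f : ∀ i, H i →* G) (X : Fin 2 → Set α) (hdisj : Disjoint (X 0) (X 1))
    (hpp : Pairwise fun i j => ∀ h : H i, h ≠ 1 → f i h • X j ⊆ X i)
    {p : α} (hp : p ∈ X 0) (hp' : ∀ h : H 0, h ≠ 1 → p ∉ f 0 h • X 1) (hne : (X 1).Nonempty) :
    Function.Injective (lift f) := by
  classical
  have hX : ∀ i, (X i).Nonempty := Fin.forall_fin_two.2 ⟨⟨p, hp⟩, hne⟩
  have hdisj' : Pairwise (Function.onFun Disjoint X) := by
    intro i j hij
    fin_cases i <;> fin_cases j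
    · exact absurd rfl hij
    · exact hdisj
    · exact hdisj.symm
    · exact absurd rfl hij
  have h01 : ∀ w : NeWord H 0 1, lift f w.prod ≠ 1 := by
    intro w hw
    obtain ⟨l, hl, hsub⟩ := lift_neWord_smul_subset f X hpp w (k := 0) (by decide)
    obtain rfl : l = 1 := by omega
    rw [hw, one_smul] at hsub
    exact hp' _ w.head_ne_one (hsub hp)
  have key : ∀ {i j} (w : NeWord H i j), lift f w.prod ≠ 1 := by
    intro i j w
    fin_cases i <;> fin_cases j
    · exact lift_word_prod_nontrivial_of_other_i f X hX hdisj' hpp w (k := 1) (by decide)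
        (by decide)
    · exact h01 w
    · intro hw
      exact h01 w.inv (by rw [NeWord.inv_prod, map_inv, hw, inv_one])
    · exact lift_word_prod_nontrivial_of_other_i f X hX hdisj' hpp w (k := 0) (by decide)
        (by decide)
  refine (injective_iff_map_eq_one (lift f)).mpr ?_
  rw [(CoprodI.Word.equiv).forall_congr_left]
  intro w hw
  by_contra hne'
  obtain ⟨i, j, w', rfl⟩ := NeWord.of_word w (fun h => hne' (by subst h; exact Word.prod_empty))
  exact key w' hw

end Monoid.CoprodI

/-! ### Free products of cyclic groups from ping-pong -/

theorem IsFreeProductOfCyclics.of_mulEquiv {n : ℕ} {K L : Type*} [Group K] [Group L] (e : K ≃* L)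
    (h : IsFreeProductOfCyclics n L) : IsFreeProductOfCyclics n K := by
  obtain ⟨m, hm, C, hC, hcyc, ⟨e'⟩⟩ := h
  exact ⟨m, hm, C, hC, hcyc, ⟨e.trans e'⟩⟩

/-- **Klein's combination theorem** for two cyclic groups. The sets `D` and `E` play the role of
fundamental domains of `x` and `y`: the nontrivial powers of `x` move `D` off itself, those of `y`
move `E` off itself, and `D` and `E` cover everything. -/
theorem isFreeProductOfCyclics_closure_pair {G α : Type*} [Group G] [MulAction G α] {x y : G}
    {D E : Set α} {p : α} (hDE : D ∪ E = Set.univ) (hp : p ∉ D) (hE : E ≠ Set.univ)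
    (hD : ∀ g ∈ Subgroup.zpowers x, g ≠ 1 → ∀ q ∈ D, g • q ≠ p ∧ g • q ∉ D)
    (hE' : ∀ g ∈ Subgroup.zpowers y, g ≠ 1 → ∀ q ∈ E, g • q ∉ E) :
    IsFreeProductOfCyclics 2 (Subgroup.closure {x, y}) := by
  let z : Fin 2 → G := ![x, y]
  let C : Fin 2 → Type := fun i => Multiplicative (ZMod (Nat.card (Subgroup.zpowers (z i))))
  let e : ∀ i, C i ≃* Subgroup.zpowers (z i) := fun i => zmodCyclicMulEquiv inferInstance
  let f : ∀ i, C i →* G := fun i => (Subgroup.zpowers (z i)).subtype.comp (e i).toMonoidHom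
  have hmem : ∀ i (c : C i), f i c ∈ Subgroup.zpowers (z i) := fun i c => (e i c).2
  have hne : ∀ i (c : C i), c ≠ 1 → f i c ≠ 1 := by
    intro i c hc h
    exact hc ((e i).map_eq_one_iff.1 (Subtype.ext h))
  have hrange : ∀ i, (f i).range = Subgroup.zpowers (z i) := by
    intro i
    refine le_antisymm ?_ fun g hg => ⟨(e i).symm ⟨g, hg⟩, by simp [f]⟩
    rintro _ ⟨c, rfl⟩
    exact hmem i c
  have hcov : ∀ q, q ∉ E → q ∈ D := fun q hq =>
    ((Set.eq_univ_iff_forall.1 hDE q).resolve_right hq)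
  have hcov' : ∀ q, q ∉ D → q ∈ E := fun q hq =>
    ((Set.eq_univ_iff_forall.1 hDE q).resolve_left hq)
  have hinj : Function.Injective (Monoid.CoprodI.lift f) := by
    refine Monoid.CoprodI.lift_injective_of_ping_pong_of_point f ![Dᶜ, Eᶜ] ?_ ?_ (p := p) hp ?_ ?_
    · exact Set.disjoint_left.2 fun q hq hq' => hq (hcov q hq')
    · intro i j hij h hh
      fin_cases i <;> fin_cases j
      · exact absurd rfl hij
      · rintro _ ⟨q, hq, rfl⟩
        exact (hD _ (hmem 0 h) (hne 0 h hh) q (hcov q hq)).2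
      · rintro _ ⟨q, hq, rfl⟩
        exact hE' _ (hmem 1 h) (hne 1 h hh) q (hcov' q hq)
      · exact absurd rfl hij
    · rintro h hh ⟨q, hq, hqp⟩
      exact (hD _ (hmem 0 h) (hne 0 h hh) q (hcov q hq)).1 hqp
    · exact Set.nonempty_compl.2 hE
  have hK : (Monoid.CoprodI.lift f).range = Subgroup.closure {x, y} := by
    rw [Monoid.CoprodI.range_eq_iSup]
    simp only [hrange, Subgroup.zpowers_eq_closure, ← Subgroup.closure_iUnion]
    congr 1
    ext g
    simp [z, or_comm]
  refine ⟨2, le_rfl, C, fun i => inferInstance, fun i => ?_, ⟨?_⟩⟩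
  · exact isCyclic_of_surjective (e i).symm (e i).symm.surjective
  · exact ((MonoidHom.ofInjective hinj).trans (MulEquiv.subgroupCongr hK)).symm

namespace SimpleGraph

/-! ### Half-trees -/

section HalfTree

variable {V : Type*} {Γ : SimpleGraph V}

/-- The vertices of `Γ` that are closer to `v` than to `u`. If `Γ` is a tree and `u`, `v` are
adjacent, this is the component containing `v` of the tree with the edge `uv` removed. -/
def halfTree (Γ : SimpleGraph V) (u v : V) : Set V := {q | Γ.dist q v < Γ.dist q u}

theorem left_notMem_halfTree (u v : V) : u ∉ Γ.halfTree u v := by simp [halfTree]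

theorem Adj.right_mem_halfTree {u v : V} (h : Γ.Adj u v) : v ∈ Γ.halfTree u v := by
  simp [halfTree, dist_eq_one_iff_adj.2 h.symm]

/-- In a tree, seen from any vertex `q`, each vertex has at most one neighbour closer to `q`. -/
theorem IsTree.eq_of_dist_lt (hΓ : Γ.IsTree) {q u w w' : V} (hw : Γ.Adj u w) (hw' : Γ.Adj u w')
    (h : Γ.dist q w < Γ.dist q u) (h' : Γ.dist q w' < Γ.dist q u) : w = w' := by
  classical
  obtain ⟨P, hP, -⟩ := hΓ.connected.exists_path_of_dist q u
  have key : ∀ v, Γ.Adj u v → Γ.dist q v < Γ.dist q u → v = P.penultimate := by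
    intro v hv hlt
    obtain ⟨Q, hQ, hQl⟩ := hΓ.connected.exists_path_of_dist q v
    have hu : u ∉ Q.support := fun hu => by
      have h₁ := dist_le (Q.takeUntil u hu)
      have h₂ := Q.length_takeUntil_le_length hu
      omega
    exact hΓ.isAcyclic.eq_penultimate_of_adj_end hP hv
      (hΓ.isAcyclic.mem_support_of_ne_mem_support_of_adj_of_isPath hP hQ hv hu)
  rw [key w hw h, key w' hw' h']

theorem IsTree.notMem_halfTree_iff (hΓ : Γ.IsTree) {q u v : V} (h : Γ.Adj u v) :
    q ∉ Γ.halfTree u v ↔ q ∈ Γ.halfTree v u := by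
  have := hΓ.dist_ne_of_adj q h
  simp only [halfTree, Set.mem_ofPred_eq]
  omega

/-- The half-trees in different directions at a vertex are disjoint. -/
theorem IsTree.notMem_halfTree_of_ne (hΓ : Γ.IsTree) {q p u w : V} (hu : Γ.Adj p u)
    (hw : Γ.Adj p w) (hne : u ≠ w) (hq : q ∈ Γ.halfTree p u) : q ∉ Γ.halfTree p w :=
  fun hq' => hne (hΓ.eq_of_dist_lt hu hw hq hq')

/-- The half-trees cut off along a path without backtracking are nested. -/
theorem IsTree.halfTree_subset (hΓ : Γ.IsTree) {u v w : V} (huv : Γ.Adj u v) (hvw : Γ.Adj v w)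
    (hne : u ≠ w) : Γ.halfTree v w ⊆ Γ.halfTree u v := by
  intro q hq
  by_contra hq'
  exact hΓ.notMem_halfTree_of_ne hvw huv.symm hne.symm hq ((hΓ.notMem_halfTree_iff huv).1 hq')

end HalfTree

/-! ### Axes of tree automorphisms -/

section Action

variable {G V : Type*} [Group G] [MulAction G V] {Γ : SimpleGraph V}

/-- An action of `G` on a tree by automorphisms, without inversions, in which only the identity
fixes two edges with a common endpoint. -/
structure IsEdgeRigidTreeAction (G : Type*) {V : Type*} [Group G] [MulAction G V]
    (Γ : SimpleGraph V) : Prop where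
  isTree : Γ.IsTree
  adj_smul : ∀ (g : G) {u v : V}, Γ.Adj u v → Γ.Adj (g • u) (g • v)
  not_adj_smul : ∀ (g : G) (v : V), ¬ Γ.Adj v (g • v)
  eq_one : ∀ (g : G) {p u w : V}, Γ.Adj p u → Γ.Adj p w → u ≠ w →
    g • p = p → g • u = u → g • w = w → g = 1

namespace IsEdgeRigidTreeAction

theorem dist_smul (hA : IsEdgeRigidTreeAction G Γ) (g : G) (u v : V) :
    Γ.dist (g • u) (g • v) = Γ.dist u v := by
  have key : ∀ (g : G) (u v : V), Γ.dist (g • u) (g • v) ≤ Γ.dist u v := by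
    intro g u v
    obtain ⟨P, hP⟩ := hA.isTree.connected.exists_walk_length_eq_dist u v
    let φ : Γ →g Γ := ⟨fun w => g • w, fun h => hA.adj_smul g h⟩
    rw [← hP, ← Walk.length_map φ P]
    exact dist_le (P.map φ)
  refine le_antisymm (key g u v) ?_
  simpa using key g⁻¹ (g • u) (g • v)

theorem smul_mem_halfTree (hA : IsEdgeRigidTreeAction G Γ) (g : G) {q u v : V} :
    g • q ∈ Γ.halfTree (g • u) (g • v) ↔ q ∈ Γ.halfTree u v := by
  simp only [halfTree, Set.mem_ofPred_eq, hA.dist_smul]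

end IsEdgeRigidTreeAction

/-- The least distance by which `g` moves a vertex. -/
noncomputable def translationLength (Γ : SimpleGraph V) (g : G) : ℕ :=
  sInf (Set.range fun v => Γ.dist v (g • v))

theorem translationLength_le (g : G) (v : V) : Γ.translationLength g ≤ Γ.dist v (g • v) :=
  Nat.sInf_le ⟨v, rfl⟩

theorem exists_dist_eq_translationLength [Nonempty V] (g : G) :
    ∃ v, Γ.dist v (g • v) = Γ.translationLength g :=
  Nat.sInf_mem (Set.range_nonempty _)

theorem IsEdgeRigidTreeAction.dist_inv_smul (hA : IsEdgeRigidTreeAction G Γ) (g : G) (v : V) :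
    Γ.dist v (g⁻¹ • v) = Γ.dist v (g • v) := by
  rw [← hA.dist_smul g v (g⁻¹ • v), smul_inv_smul, dist_comm]

theorem IsEdgeRigidTreeAction.translationLength_inv (hA : IsEdgeRigidTreeAction G Γ) (g : G) :
    Γ.translationLength g⁻¹ = Γ.translationLength g := by
  simp only [translationLength, hA.dist_inv_smul]

/-- A line in `Γ`, without backtracking, along which `g` translates by `n > 0`. -/
structure IsAxis (Γ : SimpleGraph V) (g : G) (n : ℕ) (a : ℤ → V) : Prop where
  pos : 0 < n
  adj : ∀ i, Γ.Adj (a i) (a (i + 1))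
  ne : ∀ i, a i ≠ a (i + 2)
  smul : ∀ i, g • a i = a (i + n)

/-- A fundamental domain for the translation by `n` along the line `a`: the part of the tree
between the edges `a (-1), a 0` and `a (n - 1), a n`. -/
def axisDomain (Γ : SimpleGraph V) (n : ℕ) (a : ℤ → V) : Set V :=
  Γ.halfTree (a (-1)) (a 0) \ Γ.halfTree (a (n - 1)) (a n)

namespace IsAxis

variable {g : G} {n : ℕ} {a : ℤ → V}

theorem adj' (h : IsAxis Γ g n a) {i j : ℤ} (hij : j = i + 1) : Γ.Adj (a i) (a j) :=
  hij ▸ h.adj i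

theorem ne' (h : IsAxis Γ g n a) {i j : ℤ} (hij : j = i + 2) : a i ≠ a j :=
  hij ▸ h.ne i

theorem smul' (h : IsAxis Γ g n a) {i j : ℤ} (hij : j = i + n) : g • a i = a j :=
  hij ▸ h.smul i

theorem reverse (h : IsAxis Γ g n a) : IsAxis Γ g⁻¹ n fun i => a (-i) where
  pos := h.pos
  adj i := (h.adj' (by ring)).symm
  ne i := (h.ne' (by ring)).symm
  smul i := by
    rw [inv_smul_eq_iff, h.smul' (j := -i) (by ring)]

theorem shift (h : IsAxis Γ g n a) (k : ℤ) : IsAxis Γ g n fun i => a (i + k) where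
  pos := h.pos
  adj i := h.adj' (by ring)
  ne i := h.ne' (by ring)
  smul i := h.smul' (by ring)

theorem zpow_smul (h : IsAxis Γ g n a) (k i : ℤ) : g ^ k • a i = a (i + k * n) := by
  induction k using Int.induction_on generalizing i with
  | zero => simp
  | succ k ih =>
    rw [zpow_add_one, mul_smul, h.smul, ih]
    congr 1
    ring
  | pred k ih =>
    rw [zpow_sub_one, mul_smul, inv_smul_eq_iff.2 (h.smul' (i := i - n) (by ring)).symm, ih]
    congr 1
    ring

theorem dist_le_natCast (h : IsAxis Γ g n a) (hΓ : Γ.Connected) (i : ℤ) (k : ℕ) :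
    Γ.dist (a i) (a (i + k)) ≤ k := by
  induction k with
  | zero => simp
  | succ k ih =>
    have h₁ := hΓ.dist_triangle (u := a i) (v := a (i + k)) (w := a (i + (k + 1 : ℕ)))
    have h₂ := dist_eq_one_iff_adj.2 (h.adj' (i := i + k) (j := i + (k + 1 : ℕ))
      (by push_cast; ring))
    omega

theorem dist_le (h : IsAxis Γ g n a) (hΓ : Γ.Connected) {i j : ℤ} (hij : i ≤ j) :
    (Γ.dist (a i) (a j) : ℤ) ≤ j - i := by
  obtain ⟨k, rfl⟩ := Int.le.dest hij
  have := h.dist_le_natCast hΓ i k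
  omega

theorem halfTree_subset (h : IsAxis Γ g n a) (hΓ : Γ.IsTree) {i j : ℤ} (hij : i ≤ j) :
    Γ.halfTree (a j) (a (j + 1)) ⊆ Γ.halfTree (a i) (a (i + 1)) := by
  induction j, hij using Int.leInduction with
  | base => exact subset_rfl
  | succ j _ ih =>
    exact (hΓ.halfTree_subset (h.adj j) (h.adj _) (h.ne' (by ring))).trans ih

theorem halfTree_subset' (h : IsAxis Γ g n a) (hΓ : Γ.IsTree) {i j i' j' : ℤ} (hij : i ≤ j)
    (hi : i' = i + 1) (hj : j' = j + 1) :
    Γ.halfTree (a j) (a j') ⊆ Γ.halfTree (a i) (a i') := by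
  subst hi hj
  exact h.halfTree_subset hΓ hij

theorem zero_mem_axisDomain (h : IsAxis Γ g n a) (hΓ : Γ.IsTree) : a 0 ∈ Γ.axisDomain n a := by
  have := h.pos
  refine ⟨(h.adj' (by norm_num)).right_mem_halfTree, fun h0 => ?_⟩
  exact left_notMem_halfTree _ _
    (h.halfTree_subset' hΓ (i := 0) (i' := 1) (by omega) (by norm_num) (by ring) h0)

theorem mem_halfTree_of_notMem_axisDomain (h : IsAxis Γ g n a) (hΓ : Γ.IsTree) {q : V}
    (hq : q ∉ Γ.axisDomain n a) :
    q ∈ Γ.halfTree (a 0) (a (-1)) ∨ q ∈ Γ.halfTree (a (n - 1)) (a n) := by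
  by_contra! hq'
  exact hq ⟨(hΓ.notMem_halfTree_iff (h.adj' (by norm_num)).symm).1 hq'.1, hq'.2⟩

theorem axisDomain_ne_univ : Γ.axisDomain n a ≠ Set.univ := fun hu =>
  left_notMem_halfTree _ _ (hu ▸ Set.mem_univ (a (-1)) : a (-1) ∈ Γ.axisDomain n a).1

theorem smul_notMem_axisDomain (h : IsAxis Γ g n a) (hA : IsEdgeRigidTreeAction G Γ) {t : G}
    (ht : t ∈ Subgroup.zpowers g) (ht1 : t ≠ 1) {q : V} (hq : q ∈ Γ.axisDomain n a) :
    t • q ∉ Γ.axisDomain n a := by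
  obtain ⟨k, rfl⟩ := Subgroup.mem_zpowers_iff.1 ht
  have hn := h.pos
  rintro ⟨h₁, h₂⟩
  have h₃ := (hA.smul_mem_halfTree (g ^ k)).2 hq.1
  have h₄ := (hA.smul_mem_halfTree (g ^ k)).not.2 hq.2
  rw [h.zpow_smul, h.zpow_smul] at h₃ h₄
  rcases lt_trichotomy k 0 with hk | rfl | hk
  · exact h₄ (h.halfTree_subset' hA.isTree (by nlinarith) (by ring) (by norm_num) h₁)
  · simp at ht1
  · exact h₂ (h.halfTree_subset' hA.isTree (by nlinarith) (by ring) (by ring) h₃)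

end IsAxis

namespace IsEdgeRigidTreeAction

variable (hA : IsEdgeRigidTreeAction G Γ)
include hA

theorem two_le {g : G} {n : ℕ} {a : ℤ → V} (h : IsAxis Γ g n a) : 2 ≤ n := by
  have hn := h.pos
  by_contra hlt
  obtain rfl : n = 1 := by omega
  exact hA.not_adj_smul g (a 0) (by rw [h.smul]; exact h.adj 0)

/-- A vertex that is moved least by `g`, and moved at all, lies on an axis of `g`. -/
theorem exists_isAxis {g : G} {p : V} (hp : Γ.dist p (g • p) = Γ.translationLength g)
    (h0 : Γ.translationLength g ≠ 0) :
    ∃ a, IsAxis Γ g (Γ.translationLength g) a ∧ a 0 = p := by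
  set n := Γ.translationLength g with hn
  have hconn := hA.isTree.connected
  obtain ⟨P, hP⟩ := hconn.exists_walk_length_eq_dist p (g • p)
  rw [hp] at hP
  have hnpos : (0 : ℤ) < n := by omega
  have hn1 : n ≠ 1 := fun h1 => hA.not_adj_smul g p (dist_eq_one_iff_adj.1 (hp.trans h1))
  let a : ℤ → V := fun i => g ^ (i / n) • P.getVert (i % n).toNat
  have hadj : ∀ i, Γ.Adj (a i) (a (i + 1)) := by
    intro i
    have hr0 := Int.emod_nonneg i hnpos.ne'
    have hrn := Int.emod_lt_of_pos i hnpos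
    have hdm := Int.mul_ediv_add_emod i n
    have hstep : Γ.Adj (P.getVert (i % n).toNat) (P.getVert ((i % n).toNat + 1)) :=
      P.adj_getVert_succ (by omega)
    by_cases hr : i % n + 1 < n
    · have h₁ : (i + 1) / n = i / n := by
        rw [Int.ediv_eq_iff_of_pos hnpos]
        constructor <;> nlinarith
      have h₂ : (i + 1) % n = i % n + 1 := by
        have := Int.mul_ediv_add_emod (i + 1) n
        rw [h₁] at this
        linarith
      have h₃ : ((i + 1) % n).toNat = (i % n).toNat + 1 := by omega
      simp only [a, h₁, h₃]
      exact hA.adj_smul _ hstep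
    · have h₁ : (i + 1) / n = i / n + 1 := by
        rw [Int.ediv_eq_iff_of_pos hnpos]
        constructor <;> nlinarith
      have h₂ : (i + 1) % n = 0 := by
        have := Int.mul_ediv_add_emod (i + 1) n
        rw [h₁] at this
        nlinarith
      have h₃ : (i % n).toNat + 1 = P.length := by omega
      rw [h₃, P.getVert_length] at hstep
      simp only [a, h₁, h₂, Int.toNat_zero, Walk.getVert_zero, zpow_add_one, mul_smul]
      exact hA.adj_smul _ hstep
  have hsmul : ∀ i, g • a i = a (i + n) := by
    intro i
    simp only [a, Int.add_emod_right, Int.add_ediv_of_dvd_right (dvd_refl (n : ℤ)),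
      Int.ediv_self hnpos.ne', ← mul_smul]
    rw [add_comm, zpow_one_add]
  have hdist : ∀ (i : ℤ) (k : ℕ), Γ.dist (a i) (a (i + k)) ≤ k := by
    intro i k
    induction k with
    | zero => simp
    | succ k ih =>
      have h₁ := hconn.dist_triangle (u := a i) (v := a (i + k)) (w := a (i + (k + 1 : ℕ)))
      have h₂ := dist_eq_one_iff_adj.2 (hadj (i + k))
      rw [add_assoc] at h₂
      push_cast at h₁ ⊢
      omega
  refine ⟨a, ⟨by omega, hadj, fun i hi => ?_, hsmul⟩, by simp [a]⟩
  -- Backtracking at `a (i + 1)` would make `a i` move by at most `n - 2`.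
  have h₁ := translationLength_le (Γ := Γ) g (a i)
  have h₂ := hdist (i + 2) (n - 2)
  rw [hsmul] at h₁
  rw [← hi, show i + 2 + ((n - 2 : ℕ) : ℤ) = i + n by omega] at h₂
  omega

end IsEdgeRigidTreeAction

end Action

end SimpleGraph

/-! ### Minimal generating pairs -/

section Closure

variable {G : Type*} [Group G]

theorem Subgroup.closure_pair_inv_left (x y : G) :
    Subgroup.closure {x⁻¹, y} = Subgroup.closure {x, y} := by
  simp only [Set.insert_eq, Subgroup.closure_union, Subgroup.closure_singleton_inv]

theorem Subgroup.closure_pair_mul_right {x y t : G} (ht : t ∈ Subgroup.zpowers x) :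
    Subgroup.closure {x, y * t} = Subgroup.closure {x, y} := by
  have key : ∀ {y t : G}, t ∈ Subgroup.zpowers x →
      Subgroup.closure {x, y * t} ≤ Subgroup.closure {x, y} := by
    intro y t ht
    have hx : x ∈ Subgroup.closure {x, y} := Subgroup.subset_closure (by simp)
    have hy : y ∈ Subgroup.closure {x, y} := Subgroup.subset_closure (by simp)
    rw [Subgroup.closure_le]
    rintro g (rfl | rfl)
    · exact hx
    · exact mul_mem hy ((Subgroup.zpowers_le.2 hx) ht)
  refine le_antisymm (key ht) ?_
  simpa using key (y := y * t) (inv_mem ht)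

end Closure

namespace SimpleGraph

variable {G V : Type*} [Group G] [MulAction G V] {Γ : SimpleGraph V}

/-- Among all pairs of generators of the subgroup generated by `x` and `y`, the pair `x, y` has the
least sum of translation lengths. -/
def IsMinimalPair (Γ : SimpleGraph V) (x y : G) : Prop :=
  ∀ x' y' : G, Subgroup.closure {x', y'} = Subgroup.closure {x, y} →
    Γ.translationLength x + Γ.translationLength y ≤
      Γ.translationLength x' + Γ.translationLength y'

theorem IsMinimalPair.symm {x y : G} (h : IsMinimalPair Γ x y) : IsMinimalPair Γ y x := by
  intro x' y' h'
  have := h x' y' (h'.trans (by rw [Set.pair_comm]))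
  omega

theorem IsMinimalPair.le_mul {x y : G} (h : IsMinimalPair Γ x y) {t : G}
    (ht : t ∈ Subgroup.zpowers x) : Γ.translationLength y ≤ Γ.translationLength (y * t) := by
  have := h x (y * t) (Subgroup.closure_pair_mul_right ht)
  omega

namespace IsEdgeRigidTreeAction

variable (hA : IsEdgeRigidTreeAction G Γ)
include hA

theorem isMinimalPair_inv_left {x y : G} (h : IsMinimalPair Γ x y) : IsMinimalPair Γ x⁻¹ y := by
  intro x' y' h'
  rw [hA.translationLength_inv]
  exact h x' y' (h'.trans (Subgroup.closure_pair_inv_left x y))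

/-! ### Two-generated groups acting on trees -/

/-- If a nontrivial power of `x` fixes an edge at a fixed point of `x`, then `x` fixes this edge. -/
theorem smul_eq_self_of_zpowers {x t : G} {p v : V} (hp : x • p = p)
    (ht : t ∈ Subgroup.zpowers x) (ht1 : t ≠ 1) (hv : Γ.Adj p v) (htv : t • v = v) :
    x • v = v := by
  by_contra hne
  have hxv : Γ.Adj p (x • v) := by simpa only [hp] using hA.adj_smul x hv
  obtain ⟨k, rfl⟩ := Subgroup.mem_zpowers_iff.1 ht
  refine ht1 (hA.eq_one _ hv hxv (Ne.symm hne) (smul_eq_self_of_mem_zpowers ht hp) htv ?_)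
  rw [← mul_smul, (Commute.zpow_self x k).eq, mul_smul, htv]

/-- If `x` moves `p` least but moves its neighbour `v` farther, then the nontrivial powers of `x`
move the half-tree at `p` in the direction of `v` off itself and off `p`. -/
theorem smul_notMem_halfTree {x t : G} {p v : V}
    (hp : Γ.dist p (x • p) = Γ.translationLength x) (hv : Γ.Adj p v)
    (hvx : Γ.dist v (x • v) ≠ Γ.translationLength x) (ht : t ∈ Subgroup.zpowers x) (ht1 : t ≠ 1)
    {q : V} (hq : q ∈ Γ.halfTree p v) : t • q ≠ p ∧ t • q ∉ Γ.halfTree p v := by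
  have hΓ := hA.isTree
  have hconn := hΓ.connected
  by_cases h0 : Γ.translationLength x = 0
  · rw [h0] at hp hvx
    have hxp : x • p = p := ((hconn.dist_eq_zero_iff).1 hp).symm
    have htp := smul_eq_self_of_mem_zpowers ht hxp
    have htv : t • v ≠ v := fun htv => hvx
      ((hconn.dist_eq_zero_iff).2 (hA.smul_eq_self_of_zpowers hxp ht ht1 hv htv).symm)
    have hmem := (hA.smul_mem_halfTree t).2 hq
    rw [htp] at hmem
    refine ⟨fun h => left_notMem_halfTree p (t • v) (h ▸ hmem), ?_⟩
    exact hΓ.notMem_halfTree_of_ne (by simpa only [htp] using hA.adj_smul t hv) hv htv hmem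
  · obtain ⟨a, ha, rfl⟩ := hA.exists_isAxis hp h0
    set n := Γ.translationLength x with hn
    have hmin : ∀ i, Γ.dist (a i) (x • a i) = n := by
      intro i
      refine le_antisymm ?_ (translationLength_le x _)
      rw [ha.smul]
      exact ha.dist_le_natCast hconn i n
    have hne : ∀ i, v ≠ a i := fun i h => hvx (h ▸ hmin i)
    have hsub : Γ.halfTree (a 0) v ⊆ Γ.axisDomain n a := by
      intro q hq
      have hpos := ha.pos
      constructor
      · exact (hΓ.notMem_halfTree_iff (ha.adj' (by norm_num)).symm).1
          (hΓ.notMem_halfTree_of_ne hv (ha.adj' (by norm_num)).symm (hne _) hq)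
      · intro h
        exact hΓ.notMem_halfTree_of_ne hv (ha.adj' (j := 1) (by norm_num)) (hne _) hq
          (ha.halfTree_subset' hΓ (by omega) (by norm_num) (by ring) h)
    have hout := ha.smul_notMem_axisDomain hA ht ht1 (hsub hq)
    exact ⟨fun h => hout (h ▸ ha.zero_mem_axisDomain hΓ), fun h => hout (hsub h)⟩

/-- If no vertex is moved least by both `x` and `y`, a shortest path between the two sets of least
moved vertices separates the half-trees in which `x` and `y` act. -/
theorem isFreeProductOfCyclics_of_forall_ne {x y : G}
    (hxy : ∀ p, Γ.dist p (x • p) = Γ.translationLength x →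
      Γ.dist p (y • p) ≠ Γ.translationLength y) :
    IsFreeProductOfCyclics 2 (Subgroup.closure {x, y}) := by
  classical
  have hΓ := hA.isTree
  have hconn := hΓ.connected
  have : Nonempty V := hconn.nonempty
  have hex : ∃ m p q, Γ.dist p (x • p) = Γ.translationLength x ∧
      Γ.dist q (y • q) = Γ.translationLength y ∧ Γ.dist p q = m := by
    obtain ⟨p, hp⟩ := exists_dist_eq_translationLength (Γ := Γ) x
    obtain ⟨q, hq⟩ := exists_dist_eq_translationLength (Γ := Γ) y
    exact ⟨_, p, q, hp, hq, rfl⟩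
  obtain ⟨p, q, hp, hq, hm⟩ := Nat.find_spec hex
  have hleast : ∀ p' q', Γ.dist p' (x • p') = Γ.translationLength x →
      Γ.dist q' (y • q') = Γ.translationLength y → Nat.find hex ≤ Γ.dist p' q' :=
    fun p' q' h₁ h₂ => Nat.find_min' hex ⟨p', q', h₁, h₂, rfl⟩
  set m := Nat.find hex
  obtain ⟨P, hP⟩ := hconn.exists_walk_length_eq_dist p q
  have hPm : P.length = m := hP.trans hm
  have hm0 : 0 < m := by
    rcases Nat.eq_zero_or_pos m with h0 | h0
    · exact absurd ((hconn.dist_eq_zero_iff).1 (hm.trans h0) ▸ hq) (hxy p hp)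
    · exact h0
  have hdist : ∀ i j, i ≤ j → j ≤ m → Γ.dist (P.getVert i) (P.getVert j) = j - i := by
    have hle : ∀ i k, i + k ≤ m → Γ.dist (P.getVert i) (P.getVert (i + k)) ≤ k := by
      intro i k
      induction k with
      | zero => simp
      | succ k ih =>
        intro hk
        have h₁ := hconn.dist_triangle (u := P.getVert i) (v := P.getVert (i + k))
          (w := P.getVert (i + (k + 1)))
        have h₂ := dist_eq_one_iff_adj.2 (P.adj_getVert_succ (i := i + k) (by omega))
        rw [add_assoc] at h₂
        have := ih (by omega)
        omega
    intro i j hij hj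
    have h₁ := hle 0 i (by omega)
    have h₂ := hle i (j - i) (by omega)
    have h₃ := hle j (m - j) (by omega)
    rw [show i + (j - i) = j by omega] at h₂
    rw [show j + (m - j) = P.length by omega, P.getVert_length] at h₃
    rw [zero_add, P.getVert_zero] at h₁
    have h₄ := hconn.dist_triangle (u := p) (v := P.getVert i) (w := q)
    have h₅ := hconn.dist_triangle (u := P.getVert i) (v := P.getVert j) (w := q)
    omega
  have hp0 : P.getVert 0 = p := P.getVert_zero
  have hqm : P.getVert m = q := hPm ▸ P.getVert_length
  have hadj : ∀ i, i < m → Γ.Adj (P.getVert i) (P.getVert (i + 1)) := fun i hi =>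
    P.adj_getVert_succ (by omega)
  have hv : Γ.Adj p (P.getVert 1) := by
    have := hadj 0 hm0
    rwa [hp0] at this
  have hw : Γ.Adj q (P.getVert (m - 1)) := by
    have := hadj (m - 1) (by omega)
    rw [show m - 1 + 1 = m by omega, hqm] at this
    exact this.symm
  have hvx : Γ.dist (P.getVert 1) (x • P.getVert 1) ≠ Γ.translationLength x := by
    intro h
    have h₁ := hleast _ _ h hq
    have h₂ := hdist 1 m hm0 le_rfl
    rw [hqm] at h₂
    omega
  have hwy : Γ.dist (P.getVert (m - 1)) (y • P.getVert (m - 1)) ≠ Γ.translationLength y := by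
    intro h
    have h₁ := hleast _ _ hp h
    have h₂ := hdist 0 (m - 1) (by omega) (by omega)
    rw [hp0] at h₂
    omega
  refine isFreeProductOfCyclics_closure_pair (D := Γ.halfTree p (P.getVert 1))
    (E := Γ.halfTree q (P.getVert (m - 1))) (p := p) ?_ (left_notMem_halfTree _ _) ?_ ?_ ?_
  · refine Set.eq_univ_iff_forall.2 fun r => or_iff_not_imp_left.2 fun hr => ?_
    have key : ∀ j, j < m → r ∈ Γ.halfTree (P.getVert (j + 1)) (P.getVert j) := by
      intro j hj
      induction j with
      | zero =>
        rw [hp0]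
        exact (hΓ.notMem_halfTree_iff hv).1 hr
      | succ j ih =>
        refine hΓ.halfTree_subset (hadj _ hj).symm (hadj _ (by omega)).symm ?_ (ih (by omega))
        intro h
        have := hdist j (j + 2) (by omega) (by omega)
        rw [← h, dist_self] at this
        omega
    have := key (m - 1) (by omega)
    rwa [show m - 1 + 1 = m by omega, hqm] at this
  · exact fun h => left_notMem_halfTree _ _ (h ▸ Set.mem_univ q)
  · exact fun t ht ht1 r hr => hA.smul_notMem_halfTree hp hv hvx ht ht1 hr
  · exact fun t ht ht1 r hr => (hA.smul_notMem_halfTree hq hw hwy ht ht1 hr).2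

/-- The case of an elliptic `x` fixing no edge of the axis of `y` at the fixed point `a 0`. -/
theorem isFreeProductOfCyclics_of_fixed_vertex {x y : G} {a : ℤ → V}
    (hxy : IsMinimalPair Γ x y) (ha : IsAxis Γ y (Γ.translationLength y) a)
    (hx : x • a 0 = a 0) (h₁ : x • a 1 ≠ a 1) (h₂ : x • a (-1) ≠ a (-1)) :
    IsFreeProductOfCyclics 2 (Subgroup.closure {x, y}) := by
  have hΓ := hA.isTree
  set n := Γ.translationLength y with hn
  have hn2 := hA.two_le ha
  have hadj₁ : Γ.Adj (a 0) (a 1) := ha.adj' (by norm_num)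
  have hadj₂ : Γ.Adj (a 0) (a (-1)) := (ha.adj' (by norm_num)).symm
  have hfix : ∀ t ∈ Subgroup.zpowers x, t • a 0 = a 0 := fun t ht =>
    smul_eq_self_of_mem_zpowers ht hx
  -- Otherwise `y * t` would move `a 1` to `a (n - 1)`, against minimality.
  have hcross : ∀ t ∈ Subgroup.zpowers x, t • a 1 ≠ a (-1) := by
    intro t ht h
    have h₃ := hxy.le_mul ht
    have h₄ := translationLength_le (Γ := Γ) (y * t) (a 1)
    rw [mul_smul, h, ha.smul' (j := n - 1) (by ring)] at h₄
    have h₅ := ha.dist_le hΓ.connected (i := 1) (j := n - 1) (by omega)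
    omega
  have hcross' : ∀ t ∈ Subgroup.zpowers x, t • a (-1) ≠ a 1 := fun t ht h =>
    hcross t⁻¹ (inv_mem ht) (by rw [← h, inv_smul_smul])
  have hout : ∀ t ∈ Subgroup.zpowers x, ∀ v w, Γ.Adj (a 0) v → Γ.Adj (a 0) w → t • v ≠ w →
      ∀ q ∈ Γ.halfTree (a 0) v, t • q ∉ Γ.halfTree (a 0) w := by
    intro t ht v w hv hw hne q hq
    have h := (hA.smul_mem_halfTree t).2 hq
    have hv' := hA.adj_smul t hv
    rw [hfix t ht] at h hv'
    exact hΓ.notMem_halfTree_of_ne hv' hw hne h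
  refine isFreeProductOfCyclics_closure_pair (p := a 0)
    (D := Γ.halfTree (a 0) (a 1) ∪ Γ.halfTree (a 0) (a (-1))) (E := Γ.axisDomain n a)
    ?_ ?_ IsAxis.axisDomain_ne_univ ?_ ?_
  · refine Set.eq_univ_iff_forall.2 fun r => or_iff_not_imp_right.2 fun hr => ?_
    rcases ha.mem_halfTree_of_notMem_axisDomain hΓ hr with h | h
    · exact Or.inr h
    · exact Or.inl (ha.halfTree_subset' hΓ (by omega) (by norm_num) (by ring) h)
  · exact fun h => h.elim (left_notMem_halfTree _ _) (left_notMem_halfTree _ _)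
  · intro t ht ht1 q hq
    constructor
    · intro h
      rw [smul_eq_iff_eq_inv_smul, hfix _ (inv_mem ht)] at h
      subst h
      exact hq.elim (left_notMem_halfTree _ _) (left_notMem_halfTree _ _)
    · have h₁' : t • a 1 ≠ a 1 := fun h =>
        h₁ (hA.smul_eq_self_of_zpowers hx ht ht1 hadj₁ h)
      have h₂' : t • a (-1) ≠ a (-1) := fun h =>
        h₂ (hA.smul_eq_self_of_zpowers hx ht ht1 hadj₂ h)
      rintro (h | h) <;> rcases hq with hq | hq
      · exact hout t ht _ _ hadj₁ hadj₁ h₁' q hq h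
      · exact hout t ht _ _ hadj₂ hadj₁ (hcross' t ht) q hq h
      · exact hout t ht _ _ hadj₁ hadj₂ (hcross t ht) q hq h
      · exact hout t ht _ _ hadj₂ hadj₂ h₂' q hq h
  · exact fun t ht ht1 q hq => ha.smul_notMem_axisDomain hA ht ht1 hq

/-- The case of an elliptic `x` fixing an edge of the axis of `y`. -/
theorem isFreeProductOfCyclics_of_fixed_edge {x y : G} {n : ℕ} {a : ℤ → V}
    (ha : IsAxis Γ y n a) (hx : x • a 0 = a 0) (hx' : x • a 1 = a 1) :
    IsFreeProductOfCyclics 2 (Subgroup.closure {x, y}) := by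
  have hΓ := hA.isTree
  have hn2 := hA.two_le ha
  have hadj₁ : Γ.Adj (a 0) (a 1) := ha.adj' (by norm_num)
  have hadj₂ : Γ.Adj (a 0) (a (-1)) := (ha.adj' (by norm_num)).symm
  have hadj₃ : Γ.Adj (a 1) (a 2) := ha.adj' (by norm_num)
  have hne₁ : a (-1) ≠ a 1 := ha.ne' (by norm_num)
  have hne₂ : a 0 ≠ a 2 := ha.ne' (by norm_num)
  have hsub : Γ.halfTree (a 1) (a 2) ⊆ Γ.halfTree (a 0) (a 1) :=
    hΓ.halfTree_subset hadj₁ hadj₃ hne₂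
  have hp : a 0 ∉ Γ.halfTree (a 0) (a (-1)) ∪ Γ.halfTree (a 1) (a 2) := fun h =>
    h.elim (left_notMem_halfTree _ _) fun h => left_notMem_halfTree _ _ (hsub h)
  refine isFreeProductOfCyclics_closure_pair (p := a 0)
    (D := Γ.halfTree (a 0) (a (-1)) ∪ Γ.halfTree (a 1) (a 2)) (E := Γ.axisDomain n a)
    ?_ hp IsAxis.axisDomain_ne_univ ?_ ?_
  · refine Set.eq_univ_iff_forall.2 fun r => or_iff_not_imp_right.2 fun hr => ?_
    rcases ha.mem_halfTree_of_notMem_axisDomain hΓ hr with h | h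
    · exact Or.inl h
    · exact Or.inr (ha.halfTree_subset' hΓ (by omega) (by norm_num) (by ring) h)
  · intro t ht ht1 q hq
    have h0 := smul_eq_self_of_mem_zpowers ht hx
    have h1 := smul_eq_self_of_mem_zpowers ht hx'
    refine ⟨fun h => ?_, fun h => ?_⟩
    · rw [smul_eq_iff_eq_inv_smul, smul_eq_self_of_mem_zpowers (inv_mem ht) hx] at h
      exact hp (h ▸ hq)
    · rcases hq with hq | hq
      · have hm := (hA.smul_mem_halfTree t).2 hq
        have hadj := hA.adj_smul t hadj₂
        rw [h0] at hm hadj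
        rcases h with h | h
        · refine hΓ.notMem_halfTree_of_ne hadj hadj₂ (fun he => ht1 ?_) hm h
          exact hA.eq_one t hadj₂ hadj₁ hne₁ h0 he h1
        · refine hΓ.notMem_halfTree_of_ne hadj hadj₁ (fun he => hne₁ ?_) hm (hsub h)
          rw [← h1] at he
          exact smul_left_cancel t he
      · have hm := (hA.smul_mem_halfTree t).2 hq
        have hadj := hA.adj_smul t hadj₃
        rw [h1] at hm hadj
        rcases h with h | h
        · refine hΓ.notMem_halfTree_of_ne hadj hadj₁.symm (fun he => hne₂ ?_) hm
            (hΓ.halfTree_subset hadj₁.symm hadj₂ hne₁.symm h)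
          rw [← h0] at he
          exact (smul_left_cancel t he).symm
        · refine hΓ.notMem_halfTree_of_ne hadj hadj₃ (fun he => ht1 ?_) hm h
          exact hA.eq_one t hadj₁.symm hadj₃ hne₂ h1 h0 he
  · exact fun t ht ht1 q hq => ha.smul_notMem_axisDomain hA ht ht1 hq

theorem isFreeProductOfCyclics_of_elliptic {x y : G} {p : V} (hxy : IsMinimalPair Γ x y)
    (hx : x • p = p) (hp : Γ.dist p (y • p) = Γ.translationLength y)
    (h0 : Γ.translationLength y ≠ 0) :
    IsFreeProductOfCyclics 2 (Subgroup.closure {x, y}) := by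
  obtain ⟨a, ha, rfl⟩ := hA.exists_isAxis hp h0
  by_cases h₁ : x • a 1 = a 1
  · exact hA.isFreeProductOfCyclics_of_fixed_edge ha hx h₁
  by_cases h₂ : x • a (-1) = a (-1)
  · have := hA.isFreeProductOfCyclics_of_fixed_edge ha.reverse (x := x) hx h₂
    rwa [Set.pair_comm, Subgroup.closure_pair_inv_left, Set.pair_comm] at this
  exact hA.isFreeProductOfCyclics_of_fixed_vertex hxy ha hx h₁ h₂

/-- The axes of a minimal pair of hyperbolic elements do not share a segment as long as the shorter
of the two translation lengths. -/
theorem ne_of_isMinimalPair {x y : G} {a b : ℤ → V} (hxy : IsMinimalPair Γ x y)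
    (ha : IsAxis Γ x (Γ.translationLength x) a) (hb : IsAxis Γ y (Γ.translationLength y) b)
    (hle : Γ.translationLength x ≤ Γ.translationLength y) (h0 : a 0 = b 0) :
    a (Γ.translationLength x) ≠ b (Γ.translationLength x) := by
  intro h
  have h₁ := hxy.le_mul (inv_mem (Subgroup.mem_zpowers x))
  have h₂ := translationLength_le (Γ := Γ) (y * x⁻¹) (b (Γ.translationLength x))
  have h₃ := hb.dist_le hA.isTree.connected (Nat.cast_le (α := ℤ).2 hle)
  have h₄ : x⁻¹ • a (Γ.translationLength x) = a 0 := by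
    rw [inv_smul_eq_iff, ha.smul, zero_add]
  rw [mul_smul, ← h, h₄, h0, hb.smul, zero_add, h] at h₂
  have := ha.pos
  omega

/-- Two hyperbolic elements whose axes meet exactly in a segment shorter than both translation
lengths play ping-pong. -/
theorem isFreeProductOfCyclics_of_axes {x y : G} {m n i : ℕ} {a b : ℤ → V}
    (ha : IsAxis Γ x m a) (hb : IsAxis Γ y n b) (h0 : a 0 = b 0) (hi : a i = b i)
    (hi' : a (i + 1) ≠ b (i + 1)) (him : i < m) (hin : i < n) (h₁ : a (-1) ≠ b (-1))
    (h₂ : a (-1) ≠ b 1) (h₃ : a 1 ≠ b (-1)) :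
    IsFreeProductOfCyclics 2 (Subgroup.closure {x, y}) := by
  have hΓ := hA.isTree
  have ha1 : Γ.Adj (a 0) (a 1) := ha.adj' (by norm_num)
  have ha2 : Γ.Adj (a 0) (a (-1)) := (ha.adj' (by norm_num)).symm
  have hb1 : Γ.Adj (a 0) (b 1) := h0 ▸ hb.adj' (by norm_num)
  have hb2 : Γ.Adj (a 0) (b (-1)) := h0 ▸ (hb.adj' (by norm_num)).symm
  refine isFreeProductOfCyclics_closure_pair (p := a 0)
    (D := Γ.axisDomain m a \ {a 0}) (E := Γ.axisDomain n b) ?_ (fun h => h.2 rfl)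
    IsAxis.axisDomain_ne_univ ?_ ?_
  · refine Set.eq_univ_iff_forall.2 fun r => or_iff_not_imp_right.2 fun hr => ?_
    refine ⟨by_contra fun hr' => ?_, ?_⟩
    · rcases ha.mem_halfTree_of_notMem_axisDomain hΓ hr' with h | h <;>
        rcases hb.mem_halfTree_of_notMem_axisDomain hΓ hr with h' | h'
      · rw [← h0] at h'
        exact hΓ.notMem_halfTree_of_ne ha2 hb2 h₁ h h'
      · replace h' := hb.halfTree_subset' hΓ (i := 0) (i' := 1) (by omega) (by norm_num)
          (by ring) h'
        rw [← h0] at h'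
        exact hΓ.notMem_halfTree_of_ne ha2 hb1 h₂ h h'
      · replace h := ha.halfTree_subset' hΓ (i := 0) (i' := 1) (by omega) (by norm_num)
          (by ring) h
        rw [← h0] at h'
        exact hΓ.notMem_halfTree_of_ne ha1 hb2 h₃ h h'
      · replace h := ha.halfTree_subset' hΓ (i := i) (i' := i + 1) (by omega) rfl (by ring) h
        replace h' := hb.halfTree_subset' hΓ (i := i) (i' := i + 1) (by omega) rfl (by ring) h'
        rw [← hi] at h'
        exact hΓ.notMem_halfTree_of_ne (ha.adj i) (hi ▸ hb.adj i) hi' h h'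
    · rintro rfl
      exact hr (h0 ▸ hb.zero_mem_axisDomain hΓ)
  · intro t ht ht1 q hq
    have hout := ha.smul_notMem_axisDomain hA ht ht1 hq.1
    exact ⟨fun h => hout (h ▸ ha.zero_mem_axisDomain hΓ), fun h => hout h.1⟩
  · exact fun t ht ht1 q hq => hb.smul_notMem_axisDomain hA ht ht1 hq

theorem isFreeProductOfCyclics_of_hyperbolic {x y : G} {p : V} (hxy : IsMinimalPair Γ x y)
    (hx : Γ.dist p (x • p) = Γ.translationLength x)
    (hy : Γ.dist p (y • p) = Γ.translationLength y)
    (hx0 : Γ.translationLength x ≠ 0) (hy0 : Γ.translationLength y ≠ 0) :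
    IsFreeProductOfCyclics 2 (Subgroup.closure {x, y}) := by
  obtain ⟨a₀, ha₀, h0⟩ := hA.exists_isAxis hx hx0
  obtain ⟨b₀, hb₀, h0'⟩ := hA.exists_isAxis hy hy0
  set m := Γ.translationLength x with hm
  set n := Γ.translationLength y with hn
  -- Axes of `x ^ ±1` and `y ^ ±1` that run together for at least `i` steps.
  let Q : ℕ → Prop := fun i => ∃ x' y' : G, ∃ a b : ℤ → V,
    (x' = x ∨ x' = x⁻¹) ∧ (y' = y ∨ y' = y⁻¹) ∧ IsAxis Γ x' m a ∧ IsAxis Γ y' n b ∧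
      ∀ j : ℕ, j ≤ i → a j = b j
  have hpair : ∀ x' y' : G, (x' = x ∨ x' = x⁻¹) → (y' = y ∨ y' = y⁻¹) →
      IsMinimalPair Γ x' y' ∧ Subgroup.closure {x', y'} = Subgroup.closure {x, y} ∧
        Γ.translationLength x' = m ∧ Γ.translationLength y' = n := by
    have hright : ∀ z : G, Subgroup.closure {z, y⁻¹} = Subgroup.closure {z, y} := fun z => by
      rw [Set.pair_comm, Subgroup.closure_pair_inv_left, Set.pair_comm]
    have hxy' : IsMinimalPair Γ x y⁻¹ := (hA.isMinimalPair_inv_left hxy.symm).symm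
    intro x' y' hx' hy'
    rcases hx' with hx' | hx' <;> rcases hy' with hy' | hy' <;> rw [hx', hy']
    · exact ⟨hxy, rfl, rfl, rfl⟩
    · exact ⟨hxy', hright _, rfl, hA.translationLength_inv y⟩
    · exact ⟨hA.isMinimalPair_inv_left hxy, Subgroup.closure_pair_inv_left x y,
        hA.translationLength_inv x, rfl⟩
    · exact ⟨hA.isMinimalPair_inv_left hxy', (hright _).trans (Subgroup.closure_pair_inv_left x y),
        hA.translationLength_inv x, hA.translationLength_inv y⟩
  have hbound : ∀ i, Q i → i < m ∧ i < n := by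
    rintro i ⟨x', y', a, b, hx', hy', ha, hb, hab⟩
    obtain ⟨hmin, -, hm', hn'⟩ := hpair x' y' hx' hy'
    rw [← hm'] at ha
    rw [← hn'] at hb
    by_contra hlt
    rcases le_total m n with hle | hle
    · exact hA.ne_of_isMinimalPair hmin ha hb (by omega) (hab 0 (by omega)) (hab _ (by omega))
    · exact hA.ne_of_isMinimalPair hmin.symm hb ha (by omega) (hab 0 (by omega)).symm
        (hab _ (by omega)).symm
  have hQ0 : Q 0 := ⟨x, y, a₀, b₀, .inl rfl, .inl rfl, ha₀, hb₀, fun j hj => by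
    obtain rfl : j = 0 := by omega
    simp [h0, h0']⟩
  obtain ⟨i, ⟨x', y', a, b, hx', hy', ha, hb, hab⟩, hmax⟩ : ∃ i, Q i ∧ ¬ Q (i + 1) := by
    by_contra! hstep
    have hall : ∀ i, Q i := fun i => Nat.rec hQ0 (fun i ih => hstep i ih) i
    exact lt_irrefl _ (hbound m (hall m)).1
  obtain ⟨him, hin⟩ := hbound i ⟨x', y', a, b, hx', hy', ha, hb, hab⟩
  have hab0 : a 0 = b 0 := by simpa using hab 0 (by omega)
  have hinv : ∀ {z z' : G}, (z' = z ∨ z' = z⁻¹) → (z'⁻¹ = z ∨ z'⁻¹ = z⁻¹) := by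
    rintro z z' (rfl | rfl)
    · exact .inr rfl
    · exact .inl (inv_inv _)
  have hlast : a (i + 1) ≠ b (i + 1) := by
    intro h
    refine hmax ⟨x', y', a, b, hx', hy', ha, hb, fun j hj => ?_⟩
    rcases Nat.lt_or_ge i j with hij | hij
    · obtain rfl : j = i + 1 := by omega
      exact_mod_cast h
    · exact hab j hij
  -- A common predecessor would prolong the common segment backwards.
  have h₁ : a (-1) ≠ b (-1) := by
    intro h
    refine hmax ⟨x', y', _, _, hx', hy', ha.shift (-1), hb.shift (-1), fun j hj => ?_⟩
    rcases j with _ | j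
    · simpa using h
    · simpa using hab j (by omega)
  have h₂ : a (-1) ≠ b 1 := by
    intro h
    rcases Nat.eq_zero_or_pos i with rfl | hi
    · refine hmax ⟨x'⁻¹, y', _, b, hinv hx', hy', ha.reverse, hb, fun j hj => ?_⟩
      interval_cases j
      · simpa using hab0
      · simpa using h
    · have h' : a 1 = b 1 := by simpa using hab 1 hi
      exact ha.ne' (i := -1) (j := 1) (by norm_num) (h.trans h'.symm)
  have h₃ : a 1 ≠ b (-1) := by
    intro h
    rcases Nat.eq_zero_or_pos i with rfl | hi
    · refine hmax ⟨x', y'⁻¹, a, _, hx', hinv hy', ha, hb.reverse, fun j hj => ?_⟩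
      interval_cases j
      · simpa using hab0
      · simpa using h
    · have h' : a 1 = b 1 := by simpa using hab 1 hi
      exact hb.ne' (i := -1) (j := 1) (by norm_num) (h.symm.trans h')
  rw [← (hpair x' y' hx' hy').2.1]
  exact hA.isFreeProductOfCyclics_of_axes ha hb hab0 (hab i le_rfl) hlast him hin h₁ h₂ h₃

/-- A two-generated subgroup is a free product of at most two cyclic groups or fixes a vertex. -/
theorem isFreeProductOfCyclics_or_le_stabilizer (x y : G) :
    IsFreeProductOfCyclics 2 (Subgroup.closure {x, y}) ∨
      ∃ p : V, Subgroup.closure {x, y} ≤ MulAction.stabilizer G p := by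
  induction hN : Γ.translationLength x + Γ.translationLength y using Nat.strong_induction_on
    generalizing x y with
  | _ N ih =>
  by_cases hxy : IsMinimalPair Γ x y
  swap
  · simp only [IsMinimalPair, not_forall, not_le] at hxy
    obtain ⟨x', y', hcl, hlt⟩ := hxy
    rw [← hcl]
    exact ih _ (hN ▸ hlt) x' y' rfl
  by_cases hp : ∃ p, Γ.dist p (x • p) = Γ.translationLength x ∧
      Γ.dist p (y • p) = Γ.translationLength y
  swap
  · exact .inl (hA.isFreeProductOfCyclics_of_forall_ne fun p h h' => hp ⟨p, h, h'⟩)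
  obtain ⟨p, hpx, hpy⟩ := hp
  have hfix : ∀ z : G, Γ.dist p (z • p) = Γ.translationLength z →
      Γ.translationLength z = 0 → z • p = p := fun z h h0 =>
    ((hA.isTree.connected.dist_eq_zero_iff).1 (h.trans h0)).symm
  by_cases hx0 : Γ.translationLength x = 0 <;> by_cases hy0 : Γ.translationLength y = 0
  · refine .inr ⟨p, (Subgroup.closure_le _).2 ?_⟩
    rintro z (rfl | rfl)
    · exact hfix _ hpx hx0
    · exact hfix _ hpy hy0
  · exact .inl (hA.isFreeProductOfCyclics_of_elliptic hxy (hfix _ hpx hx0) hpy hy0)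
  · rw [Set.pair_comm]
    exact .inl (hA.isFreeProductOfCyclics_of_elliptic hxy.symm (hfix _ hpy hy0) hpx hx0)
  · exact .inl (hA.isFreeProductOfCyclics_of_hyperbolic hxy hpx hpy hx0 hy0)

end IsEdgeRigidTreeAction

end SimpleGraph

/-! ### The Bass–Serre tree -/

/-- A graph is acyclic if every vertex has at most one neighbour of the same or a lower level: a
vertex of highest level on a cycle would have two. -/
theorem SimpleGraph.isAcyclic_of_level {V : Type*} {Γ : SimpleGraph V} (ℓ : V → ℕ)
    (h : ∀ v w w', Γ.Adj v w → Γ.Adj v w' → ℓ w ≤ ℓ v → ℓ w' ≤ ℓ v → w = w') : Γ.IsAcyclic := by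
  classical
  intro u c hc
  obtain ⟨v, hv, hmax⟩ := c.support.toFinset.exists_max_image ℓ ⟨u, by simp⟩
  rw [List.mem_toFinset] at hv
  have hmax' : ∀ w ∈ (c.rotate v hv).support, ℓ w ≤ ℓ v := fun w hw =>
    hmax w (List.mem_toFinset.2 ((c.mem_support_rotate_iff _ hv).1 hw))
  have hc' := hc.rotate hv
  refine hc'.snd_ne_penultimate (h v _ _ ((c.rotate v hv).adj_snd hc'.not_nil)
    ((c.rotate v hv).adj_penultimate hc'.not_nil).symm (hmax' _ ?_) (hmax' _ ?_))
  · exact Walk.getVert_mem_support _ _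
  · exact Walk.getVert_mem_support _ _

namespace Monoid.PushoutI

section Tree

variable {A : Type*} [Group A] {H : Fin 2 → Type*} [∀ i, Group (H i)] (φ : ∀ i, A →* H i)

/-- The vertices of the Bass–Serre tree of an amalgamated product of two groups: the left cosets of
the two factors. -/
abbrev TreeVertex : Type _ := Σ i : Fin 2, PushoutI φ ⧸ (of (φ := φ) i).range

variable {φ}

/-- The coset of `g` with respect to the factor `i`, as a vertex of the Bass–Serre tree. -/
def TreeVertex.mk (g : PushoutI φ) (i : Fin 2) : TreeVertex φ := ⟨i, (g : PushoutI φ ⧸ _)⟩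

theorem TreeVertex.mk_eq_mk {g g' : PushoutI φ} {i : Fin 2} :
    TreeVertex.mk g i = TreeVertex.mk g' i ↔ g⁻¹ * g' ∈ (of (φ := φ) i).range := by
  simp only [TreeVertex.mk, Sigma.mk.injEq, true_and, heq_eq_eq]
  exact QuotientGroup.eq

theorem TreeVertex.smul_mk (g g' : PushoutI φ) (i : Fin 2) :
    g • TreeVertex.mk g' i = TreeVertex.mk (g * g') i := rfl

theorem TreeVertex.exists_eq_mk (v : TreeVertex φ) : ∃ g, v = TreeVertex.mk g v.1 := by
  obtain ⟨i, q⟩ := v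
  obtain ⟨g, rfl⟩ := QuotientGroup.mk_surjective q
  exact ⟨g, rfl⟩

variable (φ) in
/-- The Bass–Serre tree: cosets of different factors are adjacent if they share an element. -/
def tree : SimpleGraph (TreeVertex φ) where
  Adj v w := v.1 ≠ w.1 ∧ ∃ g, v = TreeVertex.mk g v.1 ∧ w = TreeVertex.mk g w.1
  symm := ⟨fun _ _ ⟨hne, g, hv, hw⟩ => ⟨hne.symm, g, hw, hv⟩⟩
  loopless := ⟨fun _ h => h.1 rfl⟩

theorem tree_adj_mk (g : PushoutI φ) {i j : Fin 2} (hij : i ≠ j) :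
    (tree φ).Adj (TreeVertex.mk g i) (TreeVertex.mk g j) := ⟨hij, g, rfl, rfl⟩

/-- The neighbours of the coset of `g` are the cosets of the elements `g * h`. -/
theorem exists_of_tree_adj_mk {g : PushoutI φ} {i : Fin 2} {w : TreeVertex φ}
    (h : (tree φ).Adj (TreeVertex.mk g i) w) :
    ∃ j, j ≠ i ∧ ∃ x : H i, w = TreeVertex.mk (g * of i x) j := by
  obtain ⟨hne, g', h₁, h₂⟩ := h
  obtain ⟨x, hx⟩ := TreeVertex.mk_eq_mk.1 h₁
  exact ⟨w.1, hne.symm, x, h₂.trans (by rw [hx, mul_inv_cancel_left])⟩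

theorem tree_adj_smul (g : PushoutI φ) {v w : TreeVertex φ} (h : (tree φ).Adj v w) :
    (tree φ).Adj (g • v) (g • w) := by
  obtain ⟨hne, g', h₁, h₂⟩ := h
  rw [h₁, h₂, TreeVertex.smul_mk, TreeVertex.smul_mk]
  exact tree_adj_mk _ hne

theorem tree_connected : (tree φ).Connected := by
  have hbase : ∀ (g : PushoutI φ) (i j : Fin 2),
      (tree φ).Reachable (TreeVertex.mk g i) (TreeVertex.mk g j) := by
    intro g i j
    by_cases h : i = j
    · rw [h]
    · exact (tree_adj_mk g h).reachable
  have key : ∀ (g g' : PushoutI φ) (i : Fin 2),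
      (tree φ).Reachable (TreeVertex.mk g' i) (TreeVertex.mk (g' * g) i) := by
    intro g
    induction g using PushoutI.induction_on with
    | of j x =>
      intro g' i
      have hj : TreeVertex.mk (g' * of j x) j = TreeVertex.mk g' j :=
        (TreeVertex.mk_eq_mk.2 (by simp)).symm
      exact (hbase g' i j).trans (hj ▸ hbase (g' * of j x) j i)
    | base a =>
      intro g' i
      rw [show TreeVertex.mk (g' * base φ a) i = TreeVertex.mk g' i from
        (TreeVertex.mk_eq_mk.2 ⟨φ i a, by simp [of_apply_eq_base]⟩).symm]
    | mul x y ihx ihy =>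
      intro g' i
      rw [← mul_assoc]
      exact (ihx g' i).trans (ihy _ i)
  have : Nonempty (TreeVertex φ) := ⟨TreeVertex.mk 1 0⟩
  refine ⟨fun v w => ?_⟩
  obtain ⟨g, hv⟩ := v.exists_eq_mk
  obtain ⟨g', hw⟩ := w.exists_eq_mk
  rw [hv, hw]
  simpa using (hbase g v.1 w.1).trans (key (g⁻¹ * g') g w.1)

section Acyclic

open NormalWord

variable {d : Transversal φ} [∀ i, DecidableEq (H i)]

theorem NormalWord.equivPair_tail_smul {i : Fin 2} (x : H i) (w : NormalWord d) :
    (equivPair i (of (φ := φ) i x • w)).tail = (equivPair i w).tail := by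
  rw [summand_smul_def, Equiv.apply_symm_apply]

/-- A normal word not starting in the factor `i` is its own tail with respect to `i`. -/
theorem NormalWord.equivPair_tail_of_fstIdx_ne {i : Fin 2} (w : NormalWord d)
    (h : w.fstIdx ≠ some i) : (equivPair i w).tail = w.toWord := by
  change (CoprodI.Word.equivPair i (CoprodI.of (φ i w.head) • w.toWord)).tail = _
  rw [CoprodI.Word.equivPair_smul_same, CoprodI.Word.equivPair_eq_of_fstIdx_ne h]

/-- Either the leading letter of `w` in the factor `i` lies in the base group, or the tail of `w`
with respect to any other factor is longer than that with respect to `i`. -/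
theorem NormalWord.head_mem_or_length_lt {i j : Fin 2} (hij : j ≠ i) (w : NormalWord d) :
    (equivPair i w).head ∈ (φ i).range ∨
      (equivPair i w).tail.toList.length < (equivPair j w).tail.toList.length := by
  refine or_iff_not_imp_left.2 fun hmem => ?_
  set p := equivPair i w with hp
  have hw : w = rcons i p := ((equivPair i).symm_apply_apply w).symm
  have hne : (((d.compl i).equiv p.head).2 : H i) ≠ 1 := fun h =>
    hmem ((Subgroup.IsComplement.coe_equiv_snd_eq_one_iff_mem _ (d.one_mem _)).1 h)
  have hword : w.toWord = CoprodI.Word.cons (((d.compl i).equiv p.head).2 : H i) p.tail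
      p.fstIdx_ne hne := by
    rw [hw]
    simp only [rcons, CoprodI.Word.equivPair_symm, CoprodI.Word.rcons]
    rw [dif_neg hne]
  rw [w.equivPair_tail_of_fstIdx_ne (i := j) (by rw [hword]; simpa using hij.symm), hword]
  simp

/-- The level of the coset of `g` with respect to the factor `i`: the number of letters in the normal
form of `g⁻¹`, not counting a leading letter in the factor `i`. Any representative `g` of the coset
gives the same number. -/
noncomputable def treeLevel (d : Transversal φ) (v : TreeVertex φ) : ℕ :=
  (equivPair v.1 ((v.2.out)⁻¹ • (NormalWord.empty : NormalWord d))).tail.toList.length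

theorem treeLevel_mk (g : PushoutI φ) (i : Fin 2) :
    treeLevel d (TreeVertex.mk g i) =
      (equivPair i (g⁻¹ • (NormalWord.empty : NormalWord d))).tail.toList.length := by
  obtain ⟨⟨_, x, rfl⟩, hh⟩ := QuotientGroup.mk_out_eq_mul (of (φ := φ) i).range g
  change (equivPair i ((Quotient.out (g : PushoutI φ ⧸ (of (φ := φ) i).range))⁻¹ •
    (NormalWord.empty : NormalWord d))).tail.toList.length = _
  rw [hh, mul_inv_rev, mul_smul, ← map_inv, equivPair_tail_smul]

/-- A neighbour whose level is not higher is determined by the first letter of the normal form of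
`g⁻¹`, up to an element of the base group. -/
theorem exists_of_treeLevel_le {g : PushoutI φ} {i : Fin 2} {w : TreeVertex φ}
    (h : (tree φ).Adj (TreeVertex.mk g i) w)
    (hle : treeLevel d w ≤ treeLevel d (TreeVertex.mk g i)) :
    ∃ j, j ≠ i ∧ ∃ x : H i, w = TreeVertex.mk (g * of i x) j ∧
      x⁻¹ * (equivPair i (g⁻¹ • (NormalWord.empty : NormalWord d))).head ∈ (φ i).range := by
  obtain ⟨j, hj, x, rfl⟩ := exists_of_tree_adj_mk h
  refine ⟨j, hj, x, rfl, ?_⟩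
  rw [treeLevel_mk, treeLevel_mk, mul_inv_rev, mul_smul, ← map_inv] at hle
  have := (head_mem_or_length_lt hj
    (of (φ := φ) i x⁻¹ • g⁻¹ • (NormalWord.empty : NormalWord d))).resolve_right
      (by rw [equivPair_tail_smul]; exact not_lt.2 hle)
  rwa [summand_smul_def, Equiv.apply_symm_apply] at this

end Acyclic

theorem tree_isAcyclic (hinj : ∀ i, Function.Injective (φ i)) : (tree φ).IsAcyclic := by
  classical
  obtain ⟨d⟩ := NormalWord.transversal_nonempty φ hinj
  refine SimpleGraph.isAcyclic_of_level (treeLevel d) fun v w w' h h' hle hle' => ?_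
  obtain ⟨g, hv⟩ := v.exists_eq_mk
  generalize v.1 = i at hv
  subst hv
  obtain ⟨j, hj, x, rfl, hx⟩ := exists_of_treeLevel_le h hle
  obtain ⟨j', hj', x', rfl, hx'⟩ := exists_of_treeLevel_le h' hle'
  obtain rfl : j = j' := by omega
  obtain ⟨a, ha⟩ := mul_mem hx (inv_mem hx')
  refine TreeVertex.mk_eq_mk.2 ⟨φ j a, ?_⟩
  rw [of_apply_eq_base, ← of_apply_eq_base φ i, ha]
  simp

/-- If the amalgamated subgroup is malnormal, an element of the amalgamated product fixing two edges
with a common endpoint is trivial. -/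
theorem isEdgeRigidTreeAction_tree (hinj : ∀ i, Function.Injective (φ i))
    (hmal : (base φ).range.IsMalnormal) :
    (tree φ).IsEdgeRigidTreeAction (PushoutI φ) where
  isTree := ⟨tree_connected, tree_isAcyclic hinj⟩
  adj_smul := tree_adj_smul
  not_adj_smul g v h := h.1 rfl
  eq_one g p u w hu hw hne hp hgu hgw := by
    have hfix : ∀ (k : PushoutI φ) (i : Fin 2), g • TreeVertex.mk k i = TreeVertex.mk k i →
        k⁻¹ * g * k ∈ (of (φ := φ) i).range := by
      intro k i h
      rw [TreeVertex.smul_mk, eq_comm, TreeVertex.mk_eq_mk] at h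
      rwa [mul_assoc]
    obtain ⟨hne₁, k₁, hpk₁, huk⟩ := hu
    obtain ⟨hne₂, k₂, hpk₂, hwk⟩ := hw
    have h12 : u.1 = w.1 := by omega
    have hk₁ : k₁⁻¹ * g * k₁ ∈ (base φ).range := by
      rw [← inf_of_range_eq_base_range hinj hne₁]
      exact ⟨hfix _ _ (hpk₁ ▸ hp), hfix _ _ (huk ▸ hgu)⟩
    have hk₂ : k₂⁻¹ * g * k₂ ∈ (base φ).range := by
      rw [← inf_of_range_eq_base_range hinj hne₂]
      exact ⟨hfix _ _ (hpk₂ ▸ hp), hfix _ _ (hwk ▸ hgw)⟩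
    have hout : k₂⁻¹ * k₁ ∉ (base φ).range := by
      rintro ⟨a, ha⟩
      refine hne ?_
      rw [huk, hwk, ← h12]
      refine (TreeVertex.mk_eq_mk.2 ⟨φ u.1 a, ?_⟩).symm
      rw [of_apply_eq_base, ha]
    have h1 := hmal _ hout _ hk₁ (by convert hk₂ using 1; group)
    rwa [mul_assoc, inv_mul_eq_one, eq_comm, mul_eq_right] at h1

end Tree

end Monoid.PushoutI

/-! ### Two-generated subgroups of the amalgamated product -/

/-- An `n`-generated subgroup inside the image of an embedding of `L` is isomorphic to an
`n`-generated subgroup of `L`. -/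
theorem IsNFreeProductOfCyclics.of_le_range {G L : Type*} [Group G] [Group L] {n : ℕ}
    (hL : IsNFreeProductOfCyclics n L) {f : L →* G} (hf : Function.Injective f) {K : Subgroup G}
    (hK : K.IsNGenerated n) (hle : K ≤ f.range) : IsFreeProductOfCyclics n K := by
  obtain ⟨g, rfl⟩ := hK
  choose x hx using fun i => hle (Subgroup.subset_closure ⟨i, rfl⟩ :
    g i ∈ Subgroup.closure (Set.range g))
  have hmap : (Subgroup.closure (Set.range x)).map f = Subgroup.closure (Set.range g) := by
    rw [MonoidHom.map_closure, ← Set.range_comp]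
    congr 2
    exact funext hx
  exact (hL.of_isNGenerated _ ⟨x, rfl⟩).of_mulEquiv
    (((Subgroup.closure (Set.range x)).equivMapOfInjective f hf).trans
      (MulEquiv.subgroupCongr hmap)).symm

theorem proposition3p2 {A : Type*} [Group A] [IsCyclic A] [Infinite A]
    {H : Fin 2 → Type*} [∀ i, Group (H i)] [∀ i, Group.FG (H i)]
    (φ : ∀ i, A →* H i)
    (hinj : ∀ i, Function.Injective (φ i))
    (hproper : ∀ i, (φ i).range ≠ ⊤)
    (hmal : (Monoid.PushoutI.base φ).range.IsMalnormal)
    (hrank : ∀ i, 2 ≤ Group.rank (H i))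
    (hfree : ∀ i, IsNFreeProductOfCyclics 2 (H i)) :
    IsNFreeProductOfCyclics 2 (Monoid.PushoutI φ) ∧
      ∀ K : Subgroup (Monoid.PushoutI φ), K.IsNGenerated 2 → IsFreeProductOfCyclics 2 K := by
  have hof := Monoid.PushoutI.of_injective (φ := φ) hinj
  have main : ∀ K : Subgroup (Monoid.PushoutI φ), K.IsNGenerated 2 → IsFreeProductOfCyclics 2 K := by
    intro K hK
    obtain ⟨g, rfl⟩ := id hK
    have hpair : Set.range g = {g 0, g 1} := by
      ext z
      simp [Fin.exists_fin_two, eq_comm]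
    rcases (Monoid.PushoutI.isEdgeRigidTreeAction_tree hinj hmal).isFreeProductOfCyclics_or_le_stabilizer
      (g 0) (g 1) with h | ⟨p, hp⟩
    · rwa [hpair]
    · obtain ⟨k, hk⟩ := p.exists_eq_mk
      let f : H p.1 →* Monoid.PushoutI φ := (MulAut.conj k).toMonoidHom.comp (Monoid.PushoutI.of p.1)
      -- The stabilizer of the coset `k H` is the conjugate of the factor `H` by `k`.
      refine (hfree p.1).of_le_range (f := f) ((MulAut.conj k).injective.comp (hof p.1)) hK ?_
      intro z hz
      have hzp : z • p = p := hp (hpair ▸ hz)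
      rw [hk, Monoid.PushoutI.TreeVertex.smul_mk, eq_comm,
        Monoid.PushoutI.TreeVertex.mk_eq_mk] at hzp
      obtain ⟨x, hx⟩ := hzp
      exact ⟨x, by simp [f, hx, mul_assoc]⟩
  refine ⟨⟨?_, main⟩, main⟩
  have := (hfree 0).nontrivial
  exact (hof 0).nontrivial
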